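/- Let $m,n$ be positive integers and let $G=\mathrm{Tor}(m,n)$ be the group with presentation $\langle a,b \mid a^m=b^n\rangle$. Words are finite words in the letters $a,b,a^{-1},b^{-1}$, and a word is reduced if it contains no subword $xx^{-1}$ or $x^{-1}x$ with $x\in\{a,b\}$; subwords are contiguous. Then: (1) $a^m=b^n$ in $G$ and the center of $G$ is infinite cyclic; if $m$ and $n$ are both at least $2$, or $m=n=1$, then the center is generated by the element $a^m=b^n$. (2) $G$ has a finite-index subgroup that is isomorphic to $F\times\mathbb{Z}$ for some free group $F$ (possibly of rank $0$). (3) Every non-empty reduced word that represents the identity of $G$ contains one of the words $a^m$, $a^{-m}$, $b^n$, $b^{-n}$ as a subword. (4) Every word (reduced or not) that represents the identity of $G$ can be transformed into the empty word by a finite sequence of steps, each of which replaces a subword $a^m$ by $b^n$, or $b^n$ by $a^m$, or $a^{-m}$ by $b^{-n}$, or $b^{-n}$ by $a^{-m}$, or deletes a subword $xx^{-1}$ or $x^{-1}x$ with $x\in\{a,b\}$. -/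

import Mathlib

namespace TorusKnot

/-- The two letters of the alphabet. -/
inductive Gen : Type
  | a : Gen
  | b : Gen

/-- Words over `a, b, a⁻¹, b⁻¹`: the letter `(x, true)` is `x` and `(x, false)` is `x⁻¹`, as in
Mathlib's construction of free groups. Words are not assumed to be freely reduced. -/
abbrev Word : Type := List (Gen × Bool)

/-- The word `x ^ k` if `ε = true`, and the word `x ^ (-k)` if `ε = false`. -/
def powWord (x : Gen) (ε : Bool) (k : ℕ) : Word := List.replicate k (x, ε)

/-- The single relator `a ^ m * (b ^ n)⁻¹`. -/
def rels (m n : ℕ) : Set (FreeGroup Gen) :=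
  {FreeGroup.of Gen.a ^ m * (FreeGroup.of Gen.b ^ n)⁻¹}

/-- The group `Tor(m, n) = ⟨a, b ∣ a ^ m = b ^ n⟩`. -/
abbrev Tor (m n : ℕ) : Type := PresentedGroup (rels m n)

/-- The image of a letter in `Tor(m, n)`. -/
def gen (m n : ℕ) (x : Gen) : Tor m n := PresentedGroup.of x

/-- The element of `Tor(m, n)` represented by a word. -/
def value (m n : ℕ) (w : Word) : Tor m n := PresentedGroup.mk (rels m n) (FreeGroup.mk w)

/-- One rewriting step on words: delete a subword `x x⁻¹` or `x⁻¹ x`, or replace one of the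
subwords `a ^ m`, `b ^ n` by the other, or one of `a ^ (-m)`, `b ^ (-n)` by the other.
No insertion of cancelling pairs is allowed. -/
inductive Step (m n : ℕ) : Word → Word → Prop
  | free {v w : Word} : FreeGroup.Red.Step v w → Step m n v w
  | a_to_b (u v : Word) (ε : Bool) :
      Step m n (u ++ powWord Gen.a ε m ++ v) (u ++ powWord Gen.b ε n ++ v)
  | b_to_a (u v : Word) (ε : Bool) :
      Step m n (u ++ powWord Gen.b ε n ++ v) (u ++ powWord Gen.a ε m ++ v)

/-- `w` can be turned into `w'` by finitely many rewriting steps. -/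
def ReducesTo (m n : ℕ) : Word → Word → Prop := Relation.ReflTransGen (Step m n)

/-- `G` is virtually a direct product of a free group (of some rank, possibly zero) and an
infinite cyclic group. -/
def IsVirtuallyFreeTimesInt (G : Type) [Group G] : Prop :=
  ∃ (H : Subgroup G) (α : Type), H.FiniteIndex ∧
    Nonempty (H ≃* FreeGroup α × Multiplicative ℤ)

end TorusKnot

/-!
Let `z = a ^ m = b ^ n`. It commutes with both generators, and it has infinite order because its
image under the homomorphism `a ↦ n`, `b ↦ m` to `ℤ` is `m * n` (`gen_zpow_eq_one`). The quotient
`Tor(m, n) ⧸ ⟨z⟩` is the free product of `ℤ/m` and `ℤ/n` (`mem_zpowers_of_toCoprod_eq_one`).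

*Center.* A free product of nontrivial groups has trivial center: if `w` is a nonempty reduced word
and `h` is a letter from a factor other than that of the last letter of `w`, then `w h w⁻¹` is
reduced and longer than `h` (`center_coprodI_eq_bot`). So for `m, n ≠ 1` the center is `⟨z⟩`. If
one of the exponents is `1`, the group is generated by the other letter.

*Words.* Cut a word into syllables, powers of `a` and powers of `b` in alternation. By the normal
form theorem in `ℤ/m * ℤ/n`, a nonempty alternating word with value `1` has a syllable `a ^ (m * j)`
or `b ^ (n * j)` (`exists_dvd_of_value_eq_one`). In a reduced word `j ≠ 0`, so the syllable contains
one of the words `a ^ (± m)`, `b ^ (± n)`. For the rewriting statement, replace the syllable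
`a ^ (m * j)` by `b ^ (n * j)`, or conversely. It then merges with a neighbour, and the number of
syllables drops; a single syllable with value `1` is empty, since the letters have infinite order
(`spell_reducesTo_nil`).

*The finite-index subgroup.* The subgroup generated by the commutators `[a ^ i, b ^ j]` and `z` is
the kernel of `Tor(m, n) → ℤ/m × ℤ/n`. A commutator depends only on `i` modulo `m` and `j` modulo
`n`, as `z` is central, and every element is `h * b ^ j * a ^ i` with `h` in this subgroup
(`exists_eq_mul_zpow_mul_zpow`). That the commutators with `i, j` nonzero are free generators is
seen from an action of `Tor(m, n)` on `F × ℤ/m × ℤ/n`, where `F` is the free group on the pairs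
`(i, j)` of nonzero residues: `b` translates the last coordinate, `a` translates the middle one
after a conjugation chosen such that `[a ^ i, b ^ j]` acts on the fibre over `(0, 0)` as left
multiplication by the generator with index `(i, j)` (`coverAction_commutator`). Since `z` acts
trivially and has infinite order, the resulting map `F × ℤ → Tor(m, n)` is injective.
-/

namespace TorusKnot

/-! ### Generators, exponents and homomorphisms out of the group -/

/-- The letter different from the given one. -/
def Gen.other : Gen → Gen
  | .a => .b
  | .b => .a

/-- The exponent with which a letter occurs in the relation `a ^ m = b ^ n`. -/
def expo (m n : ℕ) : Gen → ℕ
  | .a => m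
  | .b => n

theorem Gen.ne_iff_eq_other {x y : Gen} : x ≠ y ↔ y = x.other := by
  cases x <;> cases y <;> simp [Gen.other]

theorem expo_pos {m n : ℕ} (hm : 0 < m) (hn : 0 < n) : ∀ x, 0 < expo m n x
  | .a => hm
  | .b => hn

theorem gen_a_pow_eq (m n : ℕ) : gen m n .a ^ m = gen m n .b ^ n := by
  have h : PresentedGroup.mk (rels m n) (FreeGroup.of Gen.a ^ m) =
      PresentedGroup.mk (rels m n) (FreeGroup.of Gen.b ^ n) :=
    PresentedGroup.mk_eq_mk_of_mul_inv_mem rfl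
  rw [map_pow, map_pow] at h
  exact h

theorem gen_pow_expo (m n : ℕ) (x : Gen) : gen m n x ^ expo m n x = gen m n .a ^ m := by
  cases x
  · rfl
  · exact (gen_a_pow_eq m n).symm

/-- The homomorphism out of `Tor(m, n)` determined by images of `a` and `b` satisfying the
relation. -/
def liftTor {m n : ℕ} {K : Type*} [Group K] (f : Gen → K) (h : f .a ^ m = f .b ^ n) :
    Tor m n →* K :=
  PresentedGroup.toGroup (rels := rels m n) (f := f) (by
    rintro r rfl
    simp [h])

@[simp]
theorem liftTor_gen {m n : ℕ} {K : Type*} [Group K] (f : Gen → K) (h : f .a ^ m = f .b ^ n)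
    (x : Gen) : liftTor f h (gen m n x) = f x :=
  PresentedGroup.toGroup.of _

theorem mem_of_gen_mem {m n : ℕ} (H : Subgroup (Tor m n)) (h : ∀ x, gen m n x ∈ H)
    (g : Tor m n) : g ∈ H :=
  PresentedGroup.generated_by _ H h g

theorem gen_pow_mem_center (m n : ℕ) : gen m n .a ^ m ∈ Subgroup.center (Tor m n) := by
  rw [Subgroup.mem_center_iff]
  intro g
  refine Subgroup.mem_centralizer_singleton_iff.1
    (mem_of_gen_mem (Subgroup.centralizer {gen m n .a ^ m}) (fun x => ?_) g)
  rw [Subgroup.mem_centralizer_singleton_iff, ← gen_pow_expo m n x]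
  exact (Commute.self_pow _ _).eq

/-- The homomorphism `Tor(m, n) → ℤ` with `a ↦ n` and `b ↦ m`. -/
def degree (m n : ℕ) : Tor m n →* Multiplicative ℤ :=
  liftTor (fun x => Multiplicative.ofAdd (expo m n x.other : ℤ)) (by
    simp only [← ofAdd_nsmul, Gen.other, expo]
    simp [mul_comm])

theorem gen_zpow_eq_one {m n : ℕ} (hm : 0 < m) (hn : 0 < n) {x : Gen} {k : ℤ}
    (h : gen m n x ^ k = 1) : k = 0 := by
  have h' := congrArg (degree m n) h
  rw [map_zpow, map_one, degree, liftTor_gen, ← ofAdd_zsmul, ofAdd_eq_one, smul_eq_mul] at h'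
  have := expo_pos hm hn x.other
  rcases mul_eq_zero.1 h' with h0 | h0
  · exact h0
  · omega

/-! ### The quotient by the central element is a free product of two cyclic groups -/

/-- The factors `ℤ / m` and `ℤ / n` of the free product. -/
abbrev Factor (m n : ℕ) (x : Gen) : Type := Multiplicative (ZMod (expo m n x))

/-- The generator of the factor with index `x`, as an element of the free product. -/
def cyclicGen (m n : ℕ) (x : Gen) : Monoid.CoprodI (Factor m n) :=
  Monoid.CoprodI.of (i := x) (Multiplicative.ofAdd (1 : ZMod (expo m n x)))

theorem cyclicGen_pow_expo (m n : ℕ) (x : Gen) : cyclicGen m n x ^ expo m n x = 1 := by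
  rw [cyclicGen, ← map_pow, ← ofAdd_nsmul, nsmul_one, ZMod.natCast_self, ofAdd_zero, map_one]

theorem cyclicGen_a_pow_eq (m n : ℕ) : cyclicGen m n .a ^ m = cyclicGen m n .b ^ n :=
  (cyclicGen_pow_expo m n .a).trans (cyclicGen_pow_expo m n .b).symm

/-- The projection of `Tor(m, n)` onto the free product of `ℤ / m` and `ℤ / n`. -/
def toCoprod (m n : ℕ) : Tor m n →* Monoid.CoprodI (Factor m n) :=
  liftTor (cyclicGen m n) (cyclicGen_a_pow_eq m n)

theorem toCoprod_gen_zpow (m n : ℕ) (x : Gen) (k : ℤ) :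
    toCoprod m n (gen m n x ^ k) = Monoid.CoprodI.of (M := Factor m n) (i := x)
      (Multiplicative.ofAdd (k : ZMod (expo m n x))) := by
  rw [map_zpow, toCoprod, liftTor_gen, cyclicGen, ← map_zpow, ← ofAdd_zsmul]
  simp

theorem toCoprod_surjective (m n : ℕ) : Function.Surjective (toCoprod m n) := by
  intro p
  induction p using Monoid.CoprodI.induction_on with
  | one => exact ⟨1, map_one _⟩
  | of x u =>
    obtain ⟨k, hk⟩ := ZMod.intCast_surjective (Multiplicative.toAdd u)
    exact ⟨gen m n x ^ k, by rw [toCoprod_gen_zpow, hk, ofAdd_toAdd]⟩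
  | mul p q hp hq =>
    obtain ⟨g, rfl⟩ := hp
    obtain ⟨h, rfl⟩ := hq
    exact ⟨g * h, map_mul _ _ _⟩

/-- The inclusions of the factors induce an inverse of the map `Tor(m, n) ⧸ ⟨a ^ m⟩ → ℤ/m * ℤ/n`
given by `toCoprod`. -/
theorem mem_zpowers_of_toCoprod_eq_one {m n : ℕ} {g : Tor m n} (hg : toCoprod m n g = 1) :
    g ∈ Subgroup.zpowers (gen m n .a ^ m) := by
  set N := Subgroup.zpowers (gen m n .a ^ m) with hN
  have : N.Normal := ⟨fun k hk g => by
    rw [Subgroup.mem_center_iff.1 ((Subgroup.zpowers_le).2 (gen_pow_mem_center m n) hk) g,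
      mul_inv_cancel_right]
    exact hk⟩
  let π : Tor m n →* Tor m n ⧸ N := QuotientGroup.mk' N
  have hπ (x : Gen) : π (gen m n x) ^ expo m n x = 1 := by
    rw [← map_pow, gen_pow_expo]
    exact (QuotientGroup.eq_one_iff _).2 (Subgroup.mem_zpowers _)
  let ψ : Monoid.CoprodI (Factor m n) →* Tor m n ⧸ N := Monoid.CoprodI.lift fun x =>
    AddMonoidHom.toMultiplicativeLeft (ZMod.lift (expo m n x)
      ⟨(zmultiplesHom (Additive (Tor m n ⧸ N)) (Additive.ofMul (π (gen m n x)))), by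
        rw [zmultiplesHom_apply, natCast_zsmul, ← ofMul_pow, hπ, ofMul_one]⟩)
  have key : ψ.comp (toCoprod m n) = π := by
    refine PresentedGroup.ext fun x => ?_
    change ψ (toCoprod m n (gen m n x)) = π (gen m n x)
    have h1 := toCoprod_gen_zpow m n x 1
    rw [zpow_one] at h1
    rw [h1, Monoid.CoprodI.lift_of]
    change Additive.toMul (ZMod.lift (expo m n x) _ ((1 : ℤ) : ZMod (expo m n x))) = _
    rw [ZMod.lift_coe]
    simp
  have h1 : π g = 1 := by rw [← key, MonoidHom.comp_apply, hg, map_one]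
  exact (QuotientGroup.eq_one_iff g).1 h1

theorem coprodI_word_prod_injective {ι : Type*} (K : ι → Type*) [∀ i, Group (K i)] :
    Function.Injective (Monoid.CoprodI.Word.prod : Monoid.CoprodI.Word K → Monoid.CoprodI K) := by
  classical
  exact Monoid.CoprodI.Word.equiv.symm.injective

/-- If `w` is a nonempty reduced word and `h` is a letter from a factor other than that of the last
letter of `w`, then `w h w⁻¹` is a reduced word with at least three letters, so it is not `h`. -/
theorem center_coprodI_eq_bot {ι : Type*} [Nontrivial ι] (K : ι → Type*) [∀ i, Group (K i)]
    [∀ i, Nontrivial (K i)] : Subgroup.center (Monoid.CoprodI K) = ⊥ := by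
  classical
  rw [Subgroup.eq_bot_iff_forall]
  intro g hg
  by_contra hne
  obtain ⟨w, rfl⟩ := Monoid.CoprodI.Word.equiv.symm.surjective g
  have hw : w ≠ Monoid.CoprodI.Word.empty := by
    rintro rfl
    exact hne Monoid.CoprodI.Word.prod_empty
  obtain ⟨i, j, w, rfl⟩ := Monoid.CoprodI.NeWord.of_word w hw
  obtain ⟨k, hk⟩ := exists_ne j
  obtain ⟨h, hh⟩ := exists_ne (1 : K k)
  let s : Monoid.CoprodI.NeWord K k k := .singleton h hh
  let t : Monoid.CoprodI.NeWord K i i := .append (.append w hk.symm s) hk w.inv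
  have hprod : t.toWord.prod = s.toWord.prod := by
    change t.prod = s.prod
    rw [Monoid.CoprodI.NeWord.append_prod, Monoid.CoprodI.NeWord.append_prod,
      Monoid.CoprodI.NeWord.inv_prod, mul_inv_eq_iff_eq_mul]
    exact ((Subgroup.mem_center_iff.1 hg) s.prod).symm
  have hlen := congrArg (fun v => v.toList.length)
    (coprodI_word_prod_injective K hprod)
  have h1 := List.length_pos_of_ne_nil w.toList_ne_nil
  simp only [t, s, Monoid.CoprodI.NeWord.toWord, Monoid.CoprodI.NeWord.toList,
    List.length_append, List.length_singleton] at hlen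
  omega

/-! ### The center -/

instance : Nontrivial Gen := ⟨⟨.a, .b, by simp⟩⟩

/-- As `ℤ/m` and `ℤ/n` are nontrivial, a central element becomes trivial in their free product. -/
theorem center_eq_zpowers {m n : ℕ} (hm : m ≠ 1) (hn : n ≠ 1) :
    Subgroup.center (Tor m n) = Subgroup.zpowers (gen m n .a ^ m) := by
  refine le_antisymm (fun g hg => mem_zpowers_of_toCoprod_eq_one ?_)
    ((Subgroup.zpowers_le).2 (gen_pow_mem_center m n))
  have hnt : ∀ x, Nontrivial (Factor m n x) := fun x => by
    have : Nontrivial (ZMod (expo m n x)) := by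
      rw [ZMod.nontrivial_iff]
      cases x <;> assumption
    infer_instance
  rw [← Subgroup.mem_bot, ← center_coprodI_eq_bot (Factor m n), Subgroup.mem_center_iff]
  intro p
  obtain ⟨h, rfl⟩ := toCoprod_surjective m n p
  rw [← map_mul, ← map_mul, (Subgroup.mem_center_iff.1 hg) h]

/-- If one exponent is `1`, then the other letter generates the group. -/
theorem zpowers_eq_top {m n : ℕ} {x : Gen} (hx : expo m n x.other = 1) :
    Subgroup.zpowers (gen m n x) = ⊤ := by
  refine (Subgroup.eq_top_iff' _).2 (mem_of_gen_mem _ fun y => ?_)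
  by_cases hy : x = y
  · exact hy ▸ Subgroup.mem_zpowers _
  · have h := gen_pow_expo m n x.other
    rw [hx, pow_one, ← gen_pow_expo m n x] at h
    rw [Gen.ne_iff_eq_other.1 hy, h]
    exact Subgroup.npow_mem_zpowers _ _

theorem exists_center_eq_zpowers (m n : ℕ) :
    ∃ g : Tor m n, Subgroup.center (Tor m n) = Subgroup.zpowers g := by
  by_cases h : ∃ x, expo m n (Gen.other x) = 1
  · obtain ⟨x, hx⟩ := h
    refine ⟨gen m n x, ?_⟩
    have htop := zpowers_eq_top hx
    rw [htop, Subgroup.eq_top_iff']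
    intro g
    rw [Subgroup.mem_center_iff]
    intro k
    obtain ⟨i, rfl⟩ := Subgroup.mem_zpowers_iff.1 (htop ▸ Subgroup.mem_top g)
    obtain ⟨j, rfl⟩ := Subgroup.mem_zpowers_iff.1 (htop ▸ Subgroup.mem_top k)
    exact (Commute.zpow_zpow_self _ _ _).eq
  · push Not at h
    exact ⟨_, center_eq_zpowers (h .b) (h .a)⟩

theorem isCyclic_center (m n : ℕ) : IsCyclic (Subgroup.center (Tor m n)) := by
  obtain ⟨g, hg⟩ := exists_center_eq_zpowers m n
  rw [hg]
  infer_instance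

theorem infinite_center {m n : ℕ} (hm : 0 < m) (hn : 0 < n) :
    Infinite (Subgroup.center (Tor m n)) := by
  refine Infinite.of_injective
    (fun k : ℤ => (⟨gen m n .a ^ m, gen_pow_mem_center m n⟩ : Subgroup.center (Tor m n)) ^ k) ?_
  intro k l hkl
  have h := congrArg Subtype.val hkl
  simp only [Subgroup.coe_zpow] at h
  rw [← zpow_natCast, ← zpow_mul, ← zpow_mul, ← mul_inv_eq_one, ← zpow_neg, ← zpow_add] at h
  have h0 := gen_zpow_eq_one hm hn h
  have h1 : (m : ℤ) * (k - l) = 0 := by linarith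
  rcases mul_eq_zero.1 h1 with h2 | h2 <;> omega

theorem center_eq_zpowers_of_iff {m n : ℕ} (h : m = 1 ↔ n = 1) :
    Subgroup.center (Tor m n) = Subgroup.zpowers (gen m n .a ^ m) := by
  by_cases hm : m = 1
  · obtain rfl := hm
    obtain rfl := h.1 rfl
    have htop : Subgroup.zpowers (gen 1 1 .a ^ 1) = ⊤ := by
      rw [pow_one]
      exact zpowers_eq_top rfl
    refine le_antisymm (htop ▸ le_top) ((Subgroup.zpowers_le).2 (gen_pow_mem_center 1 1))
  · exact center_eq_zpowers hm (mt h.2 hm)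

/-! ### Syllables -/

/-- The word `x ^ k` for an integer exponent `k`. -/
def zpowWord (x : Gen) (k : ℤ) : Word := powWord x (decide (0 ≤ k)) k.natAbs

/-- The word `x₁ ^ k₁ ⋯ xᵣ ^ kᵣ` given by the list of syllables `(xᵢ, kᵢ)`. -/
def spell (L : List (Gen × ℤ)) : Word := L.flatMap fun s => zpowWord s.1 s.2

/-- Adjacent syllables are powers of different letters. -/
def Alternating (L : List (Gen × ℤ)) : Prop := L.IsChain fun s t => s.1 ≠ t.1

@[simp]
theorem spell_nil : spell [] = [] := rfl

@[simp]
theorem spell_cons (s : Gen × ℤ) (L : List (Gen × ℤ)) :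
    spell (s :: L) = zpowWord s.1 s.2 ++ spell L := rfl

@[simp]
theorem spell_append (L L' : List (Gen × ℤ)) : spell (L ++ L') = spell L ++ spell L' :=
  List.flatMap_append

theorem mk_powWord_true (x : Gen) (k : ℕ) :
    FreeGroup.mk (powWord x true k) = FreeGroup.of x ^ k := by
  induction k with
  | zero => rfl
  | succ k ih =>
    rw [pow_succ', ← ih, FreeGroup.of, FreeGroup.mul_mk]
    rfl

theorem mk_powWord_false (x : Gen) (k : ℕ) :
    FreeGroup.mk (powWord x false k) = (FreeGroup.of x ^ k)⁻¹ := by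
  rw [← mk_powWord_true, FreeGroup.inv_mk]
  simp [powWord, FreeGroup.invRev]

theorem mk_zpowWord (x : Gen) (k : ℤ) : FreeGroup.mk (zpowWord x k) = FreeGroup.of x ^ k := by
  unfold zpowWord
  rcases le_or_gt 0 k with hk | hk
  · rw [decide_eq_true hk, mk_powWord_true, ← zpow_natCast, Int.natAbs_of_nonneg hk]
  · rw [decide_eq_false hk.not_ge, mk_powWord_false, ← zpow_natCast, ← zpow_neg]
    congr 1
    omega

theorem value_append (m n : ℕ) (v w : Word) :
    value m n (v ++ w) = value m n v * value m n w := by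
  rw [value, ← FreeGroup.mul_mk, map_mul]
  rfl

theorem value_zpowWord (m n : ℕ) (x : Gen) (k : ℤ) :
    value m n (zpowWord x k) = gen m n x ^ k := by
  rw [value, mk_zpowWord, map_zpow]
  rfl

theorem value_spell (m n : ℕ) (L : List (Gen × ℤ)) :
    value m n (spell L) = (L.map fun s => gen m n s.1 ^ s.2).prod := by
  induction L with
  | nil => exact map_one _
  | cons s L ih => rw [spell_cons, value_append, value_zpowWord, ih, List.map_cons, List.prod_cons]

/-- The normal form theorem for the free product of `ℤ / m` and `ℤ / n`: if an alternating product
of syllables is trivial, then some syllable vanishes in its factor. -/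
theorem exists_dvd_of_value_eq_one {m n : ℕ} {L : List (Gen × ℤ)} (hL : Alternating L)
    (hne : L ≠ []) (h : value m n (spell L) = 1) : ∃ s ∈ L, (expo m n s.1 : ℤ) ∣ s.2 := by
  classical
  by_contra! hdvd
  let w : Monoid.CoprodI.Word (Factor m n) :=
    { toList := L.map fun s => ⟨s.1, Multiplicative.ofAdd (s.2 : ZMod (expo m n s.1))⟩
      ne_one := by
        intro l hl
        obtain ⟨s, hs, rfl⟩ := List.mem_map.1 hl
        intro h1
        exact hdvd s hs ((ZMod.intCast_zmod_eq_zero_iff_dvd _ _).1 (ofAdd_eq_one.1 h1))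
      chain_ne := by
        rw [List.isChain_map]
        exact hL }
  have hw : w.prod = Monoid.CoprodI.Word.empty.prod := by
    rw [Monoid.CoprodI.Word.prod_empty, ← map_one (toCoprod m n), ← h, value_spell, map_list_prod,
      Monoid.CoprodI.Word.prod, List.map_map, List.map_map]
    congr 1
    refine List.map_congr_left fun s _ => ?_
    exact (toCoprod_gen_zpow m n s.1 s.2).symm
  have h0 := congrArg Monoid.CoprodI.Word.toList (coprodI_word_prod_injective (Factor m n) hw)
  exact hne (List.map_eq_nil_iff.1 h0)

/-! ### Reduced words representing the identity -/

/-- Prepending a letter whose sign agrees with that of `k` increases `|k|` by one. -/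
theorem zpowWord_cons {x : Gen} {ε : Bool} {k : ℤ} (hε : ε = decide (0 ≤ k)) :
    (x, ε) :: zpowWord x k = zpowWord x (k + if ε then 1 else -1) := by
  unfold zpowWord powWord
  subst hε
  rcases le_or_gt 0 k with h | h
  · have h1 : (0 : ℤ) ≤ k + 1 := by omega
    have h2 : (k + 1).natAbs = k.natAbs + 1 := by omega
    simp [h, h1, h2, List.replicate_succ]
  · have h1 : ¬ (0 : ℤ) ≤ k + -1 := by omega
    have h2 : (k + -1).natAbs = k.natAbs + 1 := by omega
    simp only [h.not_ge, decide_false, Bool.false_eq_true, if_false, h1, h2, List.replicate_succ]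

theorem head?_zpowWord {x : Gen} {k : ℤ} (hk : k ≠ 0) :
    (zpowWord x k).head? = some (x, decide (0 ≤ k)) := by
  rw [zpowWord, powWord, List.head?_replicate, if_neg (by omega)]

/-- A reduced word is the product of its maximal syllables. -/
theorem exists_spell_eq_of_isReduced {w : Word} (hw : FreeGroup.IsReduced w) :
    ∃ L, Alternating L ∧ (∀ s ∈ L, s.2 ≠ 0) ∧ spell L = w := by
  induction w with
  | nil => exact ⟨[], List.isChain_nil, by simp, rfl⟩
  | cons p w ih =>
    obtain ⟨x, ε⟩ := p
    obtain ⟨L, hL, h0, rfl⟩ := ih (hw.infix (List.suffix_cons _ _).isInfix)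
    have hone : zpowWord x (if ε then 1 else -1) = [(x, ε)] := by
      cases ε <;> rfl
    have hone' : (if ε then 1 else -1 : ℤ) ≠ 0 := by cases ε <;> simp
    cases L with
    | nil => exact ⟨[(x, if ε then 1 else -1)], List.isChain_singleton _, by simpa using hone',
        by simp [hone]⟩
    | cons s L =>
      obtain ⟨y, k⟩ := s
      have hk : k ≠ 0 := h0 (y, k) (by simp)
      by_cases hxy : x = y
      · subst hxy
        -- Since the word is reduced, the new letter has the sign of the syllable it joins.
        have hε : ε = decide (0 ≤ k) := by
          have hhead : (spell ((x, k) :: L)).head? = some (x, decide (0 ≤ k)) := by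
            rw [spell_cons, List.head?_append, head?_zpowWord hk, Option.some_or]
          exact (List.isChain_cons.1 hw).1 _ hhead rfl
        refine ⟨(x, k + if ε then 1 else -1) :: L, ?_, ?_, ?_⟩
        · cases L with
          | nil => exact List.isChain_singleton _
          | cons t L =>
            obtain ⟨h1, h2⟩ := List.isChain_cons_cons.1 hL
            exact List.isChain_cons_cons.2 ⟨h1, h2⟩
        · intro s hs
          rcases List.mem_cons.1 hs with rfl | hs
          · subst hε
            by_cases h : 0 ≤ k
            · simp only [h, decide_true, if_true]; omega
            · simp only [h, decide_false, Bool.false_eq_true, if_false]; omega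
          · exact h0 s (List.mem_cons_of_mem _ hs)
        · rw [spell_cons, spell_cons, ← zpowWord_cons hε, List.cons_append]
      · refine ⟨(x, if ε then 1 else -1) :: (y, k) :: L, List.isChain_cons_cons.2 ⟨hxy, hL⟩, ?_, ?_⟩
        · intro s hs
          rcases List.mem_cons.1 hs with rfl | hs
          · exact hone'
          · exact h0 s hs
        · rw [spell_cons, hone, List.singleton_append]

theorem powWord_infix_zpowWord {x : Gen} {e : ℕ} {k : ℤ} (hk : k ≠ 0) (h : (e : ℤ) ∣ k) :
    powWord x (decide (0 ≤ k)) e <:+: zpowWord x k := by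
  have hle : e ≤ k.natAbs := Nat.le_of_dvd (by omega) (Int.natCast_dvd.1 h)
  refine ⟨[], powWord x (decide (0 ≤ k)) (k.natAbs - e), ?_⟩
  rw [List.nil_append, powWord, powWord, ← List.replicate_add, Nat.add_sub_cancel' hle]
  rfl

theorem exists_powWord_infix {m n : ℕ} {w : Word} (hw : FreeGroup.IsReduced w) (hne : w ≠ [])
    (h : value m n w = 1) : ∃ x ε, powWord x ε (expo m n x) <:+: w := by
  obtain ⟨L, hL, h0, rfl⟩ := exists_spell_eq_of_isReduced hw
  obtain ⟨s, hs, hdvd⟩ := exists_dvd_of_value_eq_one hL (by rintro rfl; exact hne rfl) h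
  refine ⟨s.1, _, (powWord_infix_zpowWord (h0 s hs) hdvd).trans ?_⟩
  obtain ⟨L₁, L₂, rfl⟩ := List.append_of_mem hs
  exact ⟨spell L₁, spell L₂, by simp⟩

/-! ### Rewriting to the empty word -/

theorem ReducesTo.append_append {m n : ℕ} {v w : Word} (h : ReducesTo m n v w) (p q : Word) :
    ReducesTo m n (p ++ v ++ q) (p ++ w ++ q) := by
  refine Relation.ReflTransGen.lift (fun u => p ++ u ++ q) (fun u u' hu => ?_) _ _ h
  change Step m n (p ++ u ++ q) (p ++ u' ++ q)
  cases hu with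
  | free hu => exact .free hu.append_left.append_right
  | a_to_b s t ε => simpa only [List.append_assoc] using Step.a_to_b (p ++ s) (t ++ q) ε
  | b_to_a s t ε => simpa only [List.append_assoc] using Step.b_to_a (p ++ s) (t ++ q) ε

theorem ReducesTo.of_red {m n : ℕ} {v w : Word} (h : FreeGroup.Red v w) : ReducesTo m n v w :=
  Relation.ReflTransGen.mono (fun _ _ => Step.free) _ _ h

theorem ReducesTo.value_eq {m n : ℕ} {v w : Word} (h : ReducesTo m n v w) :
    value m n v = value m n w := by
  have hpow (ε : Bool) : value m n (powWord .a ε m) = value m n (powWord .b ε n) := by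
    have h := gen_a_pow_eq m n
    cases ε
    · rw [value, value, mk_powWord_false, mk_powWord_false, map_inv, map_inv, map_pow, map_pow]
      exact congrArg _ h
    · rw [value, value, mk_powWord_true, mk_powWord_true, map_pow, map_pow]
      exact h
  induction h with
  | refl => rfl
  | tail _ hs ih =>
    rw [ih]
    cases hs with
    | free hs => exact congrArg (PresentedGroup.mk _) (FreeGroup.Red.exact.2 ⟨_, Relation.ReflTransGen.single hs, .refl⟩)
    | a_to_b s t ε => simp only [value_append, hpow]
    | b_to_a s t ε => simp only [value_append, hpow]

theorem reducesTo_zpowWord_add (m n : ℕ) (x : Gen) (k l : ℤ) :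
    ReducesTo m n (zpowWord x k ++ zpowWord x l) (zpowWord x (k + l)) := by
  classical
  have hred : FreeGroup.IsReduced (zpowWord x (k + l)) :=
    List.isChain_replicate_of_rel _ fun _ => rfl
  have h : FreeGroup.reduce (zpowWord x k ++ zpowWord x l) = zpowWord x (k + l) := by
    rw [← hred.reduce_eq]
    apply FreeGroup.reduce.sound
    rw [← FreeGroup.mul_mk, mk_zpowWord, mk_zpowWord, mk_zpowWord, zpow_add]
  exact .of_red (h ▸ FreeGroup.reduce.red)

theorem reducesTo_powWord_other (m n : ℕ) (x : Gen) (ε : Bool) (j : ℕ) :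
    ReducesTo m n (powWord x ε (expo m n x * j)) (powWord x.other ε (expo m n x.other * j)) := by
  induction j with
  | zero => exact .refl
  | succ j ih =>
    have hstep (u : Word) : Step m n (u ++ powWord x ε (expo m n x))
        (u ++ powWord x.other ε (expo m n x.other)) := by
      cases x
      · have := Step.a_to_b (m := m) (n := n) u [] ε
        rwa [List.append_nil, List.append_nil] at this
      · have := Step.b_to_a (m := m) (n := n) u [] ε
        rwa [List.append_nil, List.append_nil] at this
    have h := ih.append_append [] (powWord x ε (expo m n x))
    simp only [List.nil_append] at h
    have : ReducesTo m n _ _ := Relation.ReflTransGen.tail h (hstep _)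
    rw [Nat.mul_succ, Nat.mul_succ]
    simpa only [powWord, List.replicate_add] using this

theorem reducesTo_zpowWord_other {m n : ℕ} (hm : 0 < m) (hn : 0 < n) (x : Gen) (j : ℤ) :
    ReducesTo m n (zpowWord x (expo m n x * j)) (zpowWord x.other (expo m n x.other * j)) := by
  have h (y : Gen) : zpowWord y (expo m n y * j) =
      powWord y (decide (0 ≤ j)) (expo m n y * j.natAbs) := by
    have := expo_pos hm hn y
    rw [zpowWord, Int.natAbs_mul, Int.natAbs_natCast]
    congr 2
    rw [mul_nonneg_iff_of_pos_left (by exact_mod_cast this)]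
  rw [h, h]
  exact reducesTo_powWord_other m n x _ _

/-- A list of syllables which is not alternating can be shortened by merging two syllables. -/
theorem exists_shorter_of_not_alternating (m n : ℕ) {L : List (Gen × ℤ)} (hL : ¬ Alternating L) :
    ∃ L' : List (Gen × ℤ), L'.length < L.length ∧ ReducesTo m n (spell L) (spell L') := by
  rw [Alternating, List.isChain_iff_forall_rel_of_append_cons_cons] at hL
  push Not at hL
  obtain ⟨⟨x, k⟩, ⟨y, l⟩, L₁, L₂, rfl, hxy⟩ := hL
  obtain rfl : x = y := hxy
  refine ⟨L₁ ++ (x, k + l) :: L₂, by simp, ?_⟩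
  simpa using (reducesTo_zpowWord_add m n x k l).append_append (spell L₁) (spell L₂)

/-- Changing the letter of one of at least two alternating syllables makes it agree with a
neighbour. -/
theorem not_alternating_other {x : Gen} {k j : ℤ} {L₁ L₂ : List (Gen × ℤ)}
    (hL : Alternating (L₁ ++ (x, k) :: L₂)) (hne : L₁ ≠ [] ∨ L₂ ≠ []) :
    ¬ Alternating (L₁ ++ (x.other, j) :: L₂) := by
  rw [Alternating, List.isChain_append] at hL ⊢
  rintro ⟨-, h2, h3⟩
  obtain ⟨-, h5, h6⟩ := hL
  rcases hne with hne | hne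
  · have hl := List.getLast?_eq_getLast_of_ne_nil hne
    have h1 := h3 _ hl (x.other, j) rfl
    have h2 := h6 _ hl (x, k) rfl
    exact h1 (Gen.ne_iff_eq_other.1 h2.symm)
  · obtain ⟨t, L, rfl⟩ := List.exists_cons_of_ne_nil hne
    have h1 := (List.isChain_cons_cons.1 h2).1
    have h2 := (List.isChain_cons_cons.1 h5).1
    exact h1 (Gen.ne_iff_eq_other.1 h2).symm

/-- By induction on the number of syllables: unless there is only one, some syllable can be merged
with its neighbours, if need be after its letter has been exchanged. -/
theorem spell_reducesTo_nil {m n : ℕ} (hm : 0 < m) (hn : 0 < n) (L : List (Gen × ℤ))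
    (h : value m n (spell L) = 1) : ReducesTo m n (spell L) [] := by
  induction hr : L.length using Nat.strong_induction_on generalizing L with
  | _ r ih =>
    subst hr
    have shorten {L' : List (Gen × ℤ)} (hlen : L'.length < L.length)
        (hred : ReducesTo m n (spell L) (spell L')) : ReducesTo m n (spell L) [] :=
      hred.trans (ih _ hlen L' (hred.value_eq ▸ h) rfl)
    by_cases hL : Alternating L
    · by_cases hnil : L = []
      · subst hnil
        exact .refl
      obtain ⟨⟨x, k⟩, hs, j, hj⟩ := exists_dvd_of_value_eq_one hL hnil h
      obtain ⟨L₁, L₂, rfl⟩ := List.append_of_mem hs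
      by_cases hne : L₁ ≠ [] ∨ L₂ ≠ []
      · obtain ⟨L', hlen, hred⟩ := exists_shorter_of_not_alternating m n
          (not_alternating_other (j := expo m n x.other * j) hL hne)
        have hswap := (reducesTo_zpowWord_other hm hn x j).append_append (spell L₁) (spell L₂)
        rw [← show k = expo m n x * j from hj] at hswap
        refine shorten (by simpa using hlen) (Relation.ReflTransGen.trans ?_ hred)
        rw [spell_append, spell_append, spell_cons, spell_cons, ← List.append_assoc,
          ← List.append_assoc]
        exact hswap
      · push Not at hne
        obtain ⟨rfl, rfl⟩ := hne
        have h0 : gen m n x ^ k = 1 := by simpa [value_zpowWord] using h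
        obtain rfl := gen_zpow_eq_one hm hn h0
        exact .refl
    · obtain ⟨L', hlen, hred⟩ := exists_shorter_of_not_alternating m n hL
      exact shorten hlen hred

theorem reducesTo_nil {m n : ℕ} (hm : 0 < m) (hn : 0 < n) (w : Word) (h : value m n w = 1) :
    ReducesTo m n w [] := by
  -- Every letter of `w` is taken as a syllable of its own.
  have hw : w = spell (w.map fun p => (p.1, if p.2 then 1 else -1)) := by
    clear h
    induction w with
    | nil => rfl
    | cons p w ih =>
      obtain ⟨x, ε⟩ := p
      rw [List.map_cons, spell_cons, ← ih]
      cases ε <;> rfl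
  rw [hw] at h ⊢
  exact spell_reducesTo_nil hm hn _ h

/-! ### A finite-index subgroup isomorphic to `F × ℤ` -/

open scoped commutatorElement

/-- Pairs of nonzero residues, indexing the free generators `[a ^ i, b ^ j]`. -/
abbrev Pairs (m n : ℕ) : Type := {p : ZMod m × ZMod n // p.1 ≠ 0 ∧ p.2 ≠ 0}

/-- The free generator with index `(i, j)`, and `1` if `i` or `j` is zero. -/
noncomputable def basis (m n : ℕ) (i : ZMod m) (j : ZMod n) : FreeGroup (Pairs m n) :=
  open Classical in if h : i ≠ 0 ∧ j ≠ 0 then FreeGroup.of ⟨(i, j), h⟩ else 1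

theorem basis_of_zero {m n : ℕ} {i : ZMod m} {j : ZMod n} (h : i = 0 ∨ j = 0) :
    basis m n i j = 1 := by
  rw [basis, dif_neg (by tauto)]

/-- The set `F × ℤ/m × ℤ/n` on which `Tor(m, n)` acts. -/
abbrev Cover (m n : ℕ) : Type := FreeGroup (Pairs m n) × ZMod m × ZMod n

/-- The fibrewise left translation of `F × ℤ/m × ℤ/n` by the elements `basis m n i j`. -/
noncomputable def twist (m n : ℕ) : Equiv.Perm (Cover m n) where
  toFun p := (basis m n p.2.1 p.2.2 * p.1, p.2)
  invFun p := ((basis m n p.2.1 p.2.2)⁻¹ * p.1, p.2)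
  left_inv p := by simp
  right_inv p := by simp

/-- Translation by `-1` in the factor `ℤ/m`. -/
def shiftA (m n : ℕ) : Equiv.Perm (Cover m n) where
  toFun p := (p.1, p.2.1 - 1, p.2.2)
  invFun p := (p.1, p.2.1 + 1, p.2.2)
  left_inv p := by simp
  right_inv p := by simp

/-- Translation by `-1` in the factor `ℤ/n`. -/
def shiftB (m n : ℕ) : Equiv.Perm (Cover m n) where
  toFun p := (p.1, p.2.1, p.2.2 - 1)
  invFun p := (p.1, p.2.1, p.2.2 + 1)
  left_inv p := by simp
  right_inv p := by simp

theorem shiftA_zpow (m n : ℕ) (k : ℤ) (p : Cover m n) :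
    (shiftA m n ^ k) p = (p.1, p.2.1 - k, p.2.2) := by
  induction k using Int.induction_on generalizing p with
  | zero => simp
  | succ k ih =>
    rw [zpow_add_one, Equiv.Perm.mul_apply, ih]
    simp [shiftA, sub_sub, add_comm]
  | pred k ih =>
    rw [zpow_sub_one, Equiv.Perm.mul_apply, ih]
    have h : p.2.1 + 1 - ((-k : ℤ) : ZMod m) =
        p.2.1 - ((-k - 1 : ℤ) : ZMod m) := by
      push_cast
      ring
    rw [← h]
    rfl

theorem shiftB_zpow (m n : ℕ) (k : ℤ) (p : Cover m n) :
    (shiftB m n ^ k) p = (p.1, p.2.1, p.2.2 - k) := by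
  induction k using Int.induction_on generalizing p with
  | zero => simp
  | succ k ih =>
    rw [zpow_add_one, Equiv.Perm.mul_apply, ih]
    simp [shiftB, sub_sub, add_comm]
  | pred k ih =>
    rw [zpow_sub_one, Equiv.Perm.mul_apply, ih]
    have h : p.2.2 + 1 - ((-k : ℤ) : ZMod n) =
        p.2.2 - ((-k - 1 : ℤ) : ZMod n) := by
      push_cast
      ring
    rw [← h]
    rfl

theorem shiftA_pow_self (m n : ℕ) : shiftA m n ^ m = 1 := by
  ext1 p
  rw [← zpow_natCast, shiftA_zpow]
  simp

theorem shiftB_pow_self (m n : ℕ) : shiftB m n ^ n = 1 := by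
  ext1 p
  rw [← zpow_natCast, shiftB_zpow]
  simp

/-- The action of `Tor(m, n)` on `F × ℤ/m × ℤ/n`: the letter `b` shifts the last coordinate, and `a`
shifts the middle one after conjugation by `twist`, so that both `a ^ m` and `b ^ n` act
trivially. -/
noncomputable def coverAction (m n : ℕ) : Tor m n →* Equiv.Perm (Cover m n) :=
  liftTor (fun | .a => twist m n * shiftA m n * (twist m n)⁻¹ | .b => shiftB m n) (by
    simp only [conj_pow, shiftA_pow_self, shiftB_pow_self]
    simp)

theorem coverAction_a_zpow (m n : ℕ) (k : ℤ) (p : Cover m n) :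
    coverAction m n (gen m n .a ^ k) p =
      (basis m n (p.2.1 - k) p.2.2 * ((basis m n p.2.1 p.2.2)⁻¹ * p.1), p.2.1 - k, p.2.2) := by
  rw [map_zpow, coverAction, liftTor_gen, conj_zpow, Equiv.Perm.mul_apply, Equiv.Perm.mul_apply,
    shiftA_zpow]
  rfl

theorem coverAction_b_zpow (m n : ℕ) (k : ℤ) (p : Cover m n) :
    coverAction m n (gen m n .b ^ k) p = (p.1, p.2.1, p.2.2 - k) := by
  rw [map_zpow, coverAction, liftTor_gen, shiftB_zpow]

/-- Over `(0, 0)`, the path described by the commutator passes through `(0, j)`, `(i, j)`, `(i, 0)`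
and back to `(0, 0)`; only its step from `(0, j)` to `(i, j)` multiplies by a generator. -/
theorem coverAction_commutator (m n : ℕ) (i j : ℤ) (f : FreeGroup (Pairs m n)) :
    coverAction m n ⁅gen m n .a ^ i, gen m n .b ^ j⁆ (f, 0, 0) = (basis m n i j * f, 0, 0) := by
  rw [commutatorElement_def, ← zpow_neg, ← zpow_neg, map_mul, map_mul, map_mul,
    Equiv.Perm.mul_apply, Equiv.Perm.mul_apply, Equiv.Perm.mul_apply, coverAction_b_zpow,
    coverAction_a_zpow, coverAction_b_zpow, coverAction_a_zpow]
  simp [basis_of_zero]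

theorem coverAction_gen_pow (m n : ℕ) : coverAction m n (gen m n .a ^ m) = 1 := by
  ext1 p
  rw [← zpow_natCast, coverAction_a_zpow]
  simp

/-- The homomorphism `F × ℤ → Tor(m, n)` sending the free generators to the commutators
`[a ^ i, b ^ j]` and the generator of `ℤ` to `a ^ m`. -/
noncomputable def fromProd (m n : ℕ) : FreeGroup (Pairs m n) × Multiplicative ℤ →* Tor m n :=
  MonoidHom.noncommCoprod
    (FreeGroup.lift fun p => ⁅gen m n .a ^ (p.1.1.cast : ℤ), gen m n .b ^ (p.1.2.cast : ℤ)⁆)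
    (zpowersHom _ (gen m n .a ^ m))
    (fun f k => by
      rw [zpowersHom_apply]
      exact Subgroup.mem_center_iff.1
        (Subgroup.zpow_mem _ (gen_pow_mem_center m n) (Multiplicative.toAdd k)) _)

theorem fromProd_of (m n : ℕ) (p : Pairs m n) : fromProd m n (FreeGroup.of p, 1) =
    ⁅gen m n .a ^ (p.1.1.cast : ℤ), gen m n .b ^ (p.1.2.cast : ℤ)⁆ := by
  simp [fromProd]

theorem fromProd_ofAdd (m n : ℕ) (k : ℤ) :
    fromProd m n (1, Multiplicative.ofAdd k) = (gen m n .a ^ m) ^ k := by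
  simp [fromProd]

/-- Up to the action of `a ^ m`, which is trivial, `F` acts on its fibre over `(0, 0)` by left
translation. -/
theorem coverAction_fromProd (m n : ℕ) (f : FreeGroup (Pairs m n)) (k : Multiplicative ℤ)
    (f' : FreeGroup (Pairs m n)) :
    coverAction m n (fromProd m n (f, k)) (f', 0, 0) = (f * f', 0, 0) := by
  have hk : coverAction m n (fromProd m n (1, k)) = 1 := by
    rw [← ofAdd_toAdd k, fromProd_ofAdd, map_zpow, coverAction_gen_pow, one_zpow]
  have hof (p : Pairs m n) (f' : FreeGroup (Pairs m n)) :
      coverAction m n (fromProd m n (FreeGroup.of p, 1)) (f', 0, 0) =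
        (FreeGroup.of p * f', 0, 0) := by
    rw [fromProd_of, coverAction_commutator, ZMod.intCast_cast, ZMod.intCast_cast,
      ZMod.cast_id, ZMod.cast_id, basis, dif_pos p.2]
  have hf (f f' : FreeGroup (Pairs m n)) :
      coverAction m n (fromProd m n (f, 1)) (f', 0, 0) = (f * f', 0, 0) := by
    induction f using FreeGroup.induction_on generalizing f' with
    | C1 => rw [← Prod.one_eq_mk, map_one, map_one, one_mul]; rfl
    | of p => exact hof p f'
    | inv_of p =>
      have hinv : ((FreeGroup.of p)⁻¹, (1 : Multiplicative ℤ)) = (FreeGroup.of p, 1)⁻¹ := by simp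
      rw [hinv, map_inv, map_inv, Equiv.Perm.inv_eq_iff_eq, hof, mul_inv_cancel_left]
    | mul f g hf hg =>
      have hmul : (f * g, (1 : Multiplicative ℤ)) = (f, 1) * (g, 1) := by simp
      rw [hmul, map_mul, map_mul, Equiv.Perm.mul_apply, hg, hf, mul_assoc]
  have hsplit : (f, k) = (f, 1) * (1, k) := by simp
  rw [hsplit, map_mul, map_mul, hk, mul_one, hf]

theorem fromProd_injective {m n : ℕ} (hm : 0 < m) (hn : 0 < n) :
    Function.Injective (fromProd m n) := by
  rw [injective_iff_map_eq_one]
  rintro ⟨f, k⟩ h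
  have h1 := coverAction_fromProd m n f k 1
  rw [h, map_one, Equiv.Perm.one_apply, mul_one] at h1
  obtain rfl : 1 = f := congrArg Prod.fst h1
  obtain ⟨k, rfl⟩ := Multiplicative.ofAdd.surjective k
  rw [fromProd_ofAdd, ← zpow_natCast, ← zpow_mul] at h
  have h2 := gen_zpow_eq_one hm hn h
  have h3 : k = 0 := by
    rcases mul_eq_zero.1 h2 with h3 | h3 <;> omega
  rw [h3]
  rfl

theorem gen_zpow_expo_mem_center (m n : ℕ) (x : Gen) (q : ℤ) :
    gen m n x ^ ((expo m n x : ℤ) * q) ∈ Subgroup.center (Tor m n) := by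
  rw [zpow_mul, zpow_natCast, gen_pow_expo]
  exact Subgroup.zpow_mem _ (gen_pow_mem_center m n) q

theorem gen_zpow_expo_mem_range (m n : ℕ) (x : Gen) (q : ℤ) :
    gen m n x ^ ((expo m n x : ℤ) * q) ∈ (fromProd m n).range := by
  rw [zpow_mul, zpow_natCast, gen_pow_expo, ← fromProd_ofAdd]
  exact ⟨_, rfl⟩

theorem commutator_mul_left_of_mem_center {G : Type*} [Group G] {z : G}
    (hz : z ∈ Subgroup.center G) (g h : G) : ⁅g * z, h⁆ = ⁅g, h⁆ := by
  have hz' := Subgroup.mem_center_iff.1 hz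
  rw [commutatorElement_def, commutatorElement_def, mul_inv_rev, mul_assoc g z h, ← hz' h]
  group

theorem commutator_mul_right_of_mem_center {G : Type*} [Group G] {z : G}
    (hz : z ∈ Subgroup.center G) (g h : G) : ⁅g, h * z⁆ = ⁅g, h⁆ := by
  rw [← commutatorElement_inv, commutator_mul_left_of_mem_center hz, commutatorElement_inv]

theorem commutator_congr {m n : ℕ} {i i' j j' : ℤ} (hi : (i : ZMod m) = i')
    (hj : (j : ZMod n) = j') :
    ⁅gen m n .a ^ i, gen m n .b ^ j⁆ = ⁅gen m n .a ^ i', gen m n .b ^ j'⁆ := by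
  obtain ⟨q, hq⟩ := (ZMod.intCast_eq_intCast_iff_dvd_sub _ _ _).1 hi
  obtain ⟨r, hr⟩ := (ZMod.intCast_eq_intCast_iff_dvd_sub _ _ _).1 hj
  obtain rfl : i' = i + m * q := by omega
  obtain rfl : j' = j + n * r := by omega
  have ha : gen m n .a ^ ((m : ℤ) * q) ∈ _ := gen_zpow_expo_mem_center m n .a q
  have hb : gen m n .b ^ ((n : ℤ) * r) ∈ _ := gen_zpow_expo_mem_center m n .b r
  rw [zpow_add, zpow_add, commutator_mul_left_of_mem_center ha,
    commutator_mul_right_of_mem_center hb]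

theorem commutator_mem_range (m n : ℕ) (i j : ℤ) :
    ⁅gen m n .a ^ i, gen m n .b ^ j⁆ ∈ (fromProd m n).range := by
  by_cases h : (i : ZMod m) ≠ 0 ∧ (j : ZMod n) ≠ 0
  · refine ⟨(FreeGroup.of ⟨(i, j), h⟩, 1), ?_⟩
    rw [fromProd_of]
    exact commutator_congr (by simp) (by simp)
  · rcases not_and_or.1 h with h | h
    · rw [commutator_congr (i' := 0) (j' := j) (by simpa using h) rfl, zpow_zero,
        commutatorElement_one_left]
      exact one_mem _
    · rw [commutator_congr (i' := i) (j' := 0) rfl (by simpa using h), zpow_zero,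
        commutatorElement_one_right]
      exact one_mem _

/-- The elements `b ^ j a ^ i` represent all right cosets of the image of `F × ℤ`. -/
theorem exists_eq_mul_zpow_mul_zpow (m n : ℕ) (g : Tor m n) :
    ∃ h ∈ (fromProd m n).range, ∃ i j : ℤ, g = h * gen m n .b ^ j * gen m n .a ^ i := by
  let S : Set (Tor m n) :=
    {g | ∃ h ∈ (fromProd m n).range, ∃ i j : ℤ, g = h * gen m n .b ^ j * gen m n .a ^ i}
  have hS (x : Gen) (k : ℤ) {g : Tor m n} (hg : g ∈ S) : g * gen m n x ^ k ∈ S := by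
    obtain ⟨h, hh, i, j, rfl⟩ := hg
    cases x
    · exact ⟨h, hh, i + k, j, by group⟩
    -- `b ^ j a ^ i b ^ k` and `b ^ (j + k) a ^ i` differ by a left factor
    -- `[a ^ i, b ^ j]⁻¹ [a ^ i, b ^ (j + k)]`.
    · refine ⟨h * (⁅gen m n .a ^ i, gen m n .b ^ j⁆⁻¹ * ⁅gen m n .a ^ i, gen m n .b ^ (j + k)⁆),
        mul_mem hh (mul_mem (inv_mem (commutator_mem_range m n i j))
          (commutator_mem_range m n i (j + k))), i, j + k, ?_⟩
      simp only [commutatorElement_def]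
      group
  -- The elements `g` with `S g ⊆ S` and `S g⁻¹ ⊆ S` form a subgroup containing the generators.
  have hmul (g : Tor m n) : ∀ s ∈ S, s * g ∈ S ∧ s * g⁻¹ ∈ S := by
    let K : Subgroup (Tor m n) :=
      { carrier := {g | ∀ s ∈ S, s * g ∈ S ∧ s * g⁻¹ ∈ S}
        one_mem' := fun s hs => by simpa using hs
        mul_mem' := fun {g g'} hg hg' s hs => by
          rw [mul_inv_rev, ← mul_assoc, ← mul_assoc]
          exact ⟨(hg' _ (hg s hs).1).1, (hg _ (hg' s hs).2).2⟩
        inv_mem' := fun {g} hg s hs => by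
          rw [inv_inv]
          exact (hg s hs).symm }
    refine mem_of_gen_mem K (fun x s hs => ?_) g
    exact ⟨by simpa using hS x 1 hs, by simpa using hS x (-1) hs⟩
  have h := (hmul g 1 ⟨1, one_mem _, 0, 0, by simp⟩).1
  rwa [one_mul] at h

/-- The homomorphism `Tor(m, n) → ℤ/m × ℤ/n` with `a ↦ (1, 0)` and `b ↦ (0, 1)`. -/
def toResidues (m n : ℕ) : Tor m n →* Multiplicative (ZMod m) × Multiplicative (ZMod n) :=
  liftTor (fun | .a => (Multiplicative.ofAdd 1, 1) | .b => (1, Multiplicative.ofAdd 1)) (by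
    simp [← ofAdd_nsmul])

theorem toResidues_mul (m n : ℕ) (i j : ℤ) : toResidues m n (gen m n .b ^ j * gen m n .a ^ i) =
    (Multiplicative.ofAdd (i : ZMod m), Multiplicative.ofAdd (j : ZMod n)) := by
  rw [map_mul, map_zpow, map_zpow, toResidues, liftTor_gen, liftTor_gen]
  simp [← ofAdd_zsmul]

theorem range_le_ker_toResidues (m n : ℕ) : (fromProd m n).range ≤ (toResidues m n).ker := by
  rintro _ ⟨⟨f, k⟩, rfl⟩
  have hsplit : (f, k) = (f, 1) * (1, k) := by simp
  rw [MonoidHom.mem_ker, hsplit, map_mul, map_mul]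
  have hk : toResidues m n (fromProd m n (1, k)) = 1 := by
    rw [← ofAdd_toAdd k, fromProd_ofAdd, map_zpow, map_pow, toResidues, liftTor_gen]
    simp [← ofAdd_nsmul]
  have hf : ((toResidues m n).comp (fromProd m n)).comp (MonoidHom.inl _ _) = 1 := by
    refine FreeGroup.ext_hom _ _ fun p => ?_
    change toResidues m n (fromProd m n (FreeGroup.of p, 1)) = 1
    rw [fromProd_of, map_commutatorElement, commutatorElement_eq_one_iff_mul_comm, mul_comm]
  rw [hk, mul_one]
  exact DFunLike.congr_fun hf f

theorem ker_toResidues_le_range (m n : ℕ) : (toResidues m n).ker ≤ (fromProd m n).range := by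
  intro g hg
  obtain ⟨h, hh, i, j, rfl⟩ := exists_eq_mul_zpow_mul_zpow m n g
  rw [MonoidHom.mem_ker, mul_assoc, map_mul, MonoidHom.mem_ker.1 (range_le_ker_toResidues m n hh),
    one_mul, toResidues_mul, Prod.mk_eq_one, ofAdd_eq_one, ofAdd_eq_one,
    ZMod.intCast_zmod_eq_zero_iff_dvd, ZMod.intCast_zmod_eq_zero_iff_dvd] at hg
  obtain ⟨⟨q, rfl⟩, ⟨r, rfl⟩⟩ := hg
  exact mul_mem (mul_mem hh (gen_zpow_expo_mem_range m n .b r)) (gen_zpow_expo_mem_range m n .a q)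

theorem isVirtuallyFreeTimesInt {m n : ℕ} (hm : 0 < m) (hn : 0 < n) :
    IsVirtuallyFreeTimesInt (Tor m n) := by
  have : NeZero m := ⟨hm.ne'⟩
  have : NeZero n := ⟨hn.ne'⟩
  have : Finite (Multiplicative (ZMod m) × Multiplicative (ZMod n)) :=
    inferInstanceAs (Finite (ZMod m × ZMod n))
  exact ⟨(fromProd m n).range, Pairs m n,
    Subgroup.finiteIndex_of_le (ker_toResidues_le_range m n),
    ⟨(MonoidHom.ofInjective (fromProd_injective hm hn)).symm⟩⟩

end TorusKnot

theorem mainTheorem4 (m n : ℕ) (hm : 0 < m) (hn : 0 < n) :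
    -- (1) the center
    (IsCyclic (Subgroup.center (TorusKnot.Tor m n)) ∧
      Infinite (Subgroup.center (TorusKnot.Tor m n)) ∧
      TorusKnot.gen m n TorusKnot.Gen.a ^ m = TorusKnot.gen m n TorusKnot.Gen.b ^ n ∧
      ((m = 1 ↔ n = 1) →
        Subgroup.center (TorusKnot.Tor m n) =
          Subgroup.zpowers (TorusKnot.gen m n TorusKnot.Gen.a ^ m))) ∧
    -- (2) virtually free times infinite cyclic
    TorusKnot.IsVirtuallyFreeTimesInt (TorusKnot.Tor m n) ∧
    -- (3) subwords of reduced words that represent the identity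
    (∀ w : TorusKnot.Word, FreeGroup.IsReduced w → w ≠ [] → TorusKnot.value m n w = 1 →
      ∃ ε : Bool, TorusKnot.powWord TorusKnot.Gen.a ε m <:+: w ∨
        TorusKnot.powWord TorusKnot.Gen.b ε n <:+: w) ∧
    -- (4) rewriting to the empty word
    (∀ w : TorusKnot.Word, TorusKnot.value m n w = 1 → TorusKnot.ReducesTo m n w []) := by

  refine ⟨⟨TorusKnot.isCyclic_center m n, TorusKnot.infinite_center hm hn,
    TorusKnot.gen_a_pow_eq m n, TorusKnot.center_eq_zpowers_of_iff⟩,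
    TorusKnot.isVirtuallyFreeTimesInt hm hn, fun w hw hne h => ?_,
    TorusKnot.reducesTo_nil hm hn⟩
  obtain ⟨x, ε, hx⟩ := TorusKnot.exists_powWord_infix hw hne h
  cases x
  · exact ⟨ε, Or.inl hx⟩
  · exact ⟨ε, Or.inr hx⟩
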